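/- Let $\Omega\subset\mathbb{R}^2$ be open and let $V=V(t,x)$ be an arbitrary smooth complex-valued function on $\Omega$. Consider the equation \[ i\psi_t+\psi_{xx}+\psi^2\psi^*+V(t,x)\psi=0 \] for a complex-valued function $\psi(t,x)$, where $^*$ is complex conjugation and subscripts denote derivatives. Let $W$ be an open subset of the space $\mathbb{R}\times\mathbb{R}\times\mathbb{C}$ of the variables $(t,x,\psi)$ that lies over $\Omega$ and whose sections $\{(x,\psi):(t,x,\psi)\in W\}$, $t\in\mathbb{R}$, are connected or empty (for example $W=\mathbb{R}\times\mathbb{R}\times\mathbb{C}$ if $\Omega=\mathbb{R}^2$). The maximal Lie invariance algebra $A^{\max}(V)$ consists of all operators \[ Q=\xi^t\partial_t+\xi^x\partial_x+\eta\,\partial_\psi+\eta^*\partial_{\psi^*} \] on $W$, with real-valued $\xi^t,\xi^x$ and complex-valued $\eta$ smooth functions of $(t,x,\psi,\psi^*)$, whose second prolongation annihilates the left-hand side of the equation at every point of the second-order jet space over $W$ where this left-hand side is zero. Then every $Q\in A^{\max}(V)$ coincides on $W$ with an element of the real linear span of the operators \[ D(\xi)=\xi\partial_t+\tfrac12\xi_t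 x\,\partial_x+\tfrac18\xi_{tt}x^2M-\tfrac12\xi_t I,\qquad G(\chi)=\chi\partial_x+\tfrac12\chi_t x\,M,\qquad \lambda M, \] where $\xi=\xi(t)$, $\chi=\chi(t)$, $\lambda=\lambda(t)$ run through the real-valued smooth functions of $t$ (on the projection of $W$ to the $t$-axis), $M=i(\psi\partial_\psi-\psi^*\partial_{\psi^*})$ and $I=\psi\partial_\psi+\psi^*\partial_{\psi^*}$. Moreover, the coefficients of $Q$ satisfy on $W$ the classifying condition \[ i\eta_{\psi t}+\eta_{\psi xx}+\xi^tV_t+\xi^xV_x+\xi^t_tV=0, \] where $\partial_\psi$ is taken with $\psi$ and $\psi^*$ as independent variables (Wirtinger derivative). -/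

import Mathlib

open scoped ContDiff

noncomputable section

namespace CubicSchrodinger

/-- The space of the variables `(t, x, ψ)`. Functions of `(t, x, ψ, ψ*)` are functions on it
(differentiability being understood over `ℝ`). -/
abbrev Pt : Type := ℝ × ℝ × ℂ

/-- First-order jets `((t, x, ψ), (ψ_t, ψ_x))`. -/
abbrev Jet1 : Type := Pt × (ℂ × ℂ)

/-- Second-order jets `(((t, x, ψ), (ψ_t, ψ_x)), (ψ_tt, ψ_tx, ψ_xx))`. -/
abbrev Jet2 : Type := Jet1 × (ℂ × ℂ × ℂ)

/-- The operator `ξ^t ∂_t + ξ^x ∂_x + η ∂_ψ + η* ∂_ψ*`, with `ξ^t, ξ^x` real and `η` complex,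
is the (real) vector field `p ↦ (ξ^t p, ξ^x p, η p)`. -/
abbrev VField : Type := Pt → Pt

def xiT (Q : VField) : Pt → ℝ := fun p => (Q p).1
def xiX (Q : VField) : Pt → ℝ := fun p => (Q p).2.1
def eta (Q : VField) : Pt → ℂ := fun p => (Q p).2.2

section Prolongation

variable {E : Type} [NormedAddCommGroup E] [NormedSpace ℝ E]

/-- Total derivative `D_t` of a function of `(t, x, ψ, ψ*)`. -/
def totalT (F : Pt → E) (j : Jet1) : E := fderiv ℝ F j.1 (1, 0, j.2.1)

/-- Total derivative `D_x` of a function of `(t, x, ψ, ψ*)`. -/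
def totalX (F : Pt → E) (j : Jet1) : E := fderiv ℝ F j.1 (0, 1, j.2.2)

/-- Total derivative `D_t` of a function on the first-order jet space. -/
def totalT' (F : Jet1 → E) (j : Jet2) : E :=
  fderiv ℝ F j.1 ((1, 0, j.1.2.1), (j.2.1, j.2.2.1))

/-- Total derivative `D_x` of a function on the first-order jet space. -/
def totalX' (F : Jet1 → E) (j : Jet2) : E :=
  fderiv ℝ F j.1 ((0, 1, j.1.2.2), (j.2.2.1, j.2.2.2))

end Prolongation

/-- `η^t = D_t η - ψ_t D_t ξ^t - ψ_x D_t ξ^x`. -/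
def etaT (Q : VField) (j : Jet1) : ℂ :=
  totalT (eta Q) j - j.2.1 * (totalT (xiT Q) j : ℝ) - j.2.2 * (totalT (xiX Q) j : ℝ)

/-- `η^x = D_x η - ψ_t D_x ξ^t - ψ_x D_x ξ^x`. -/
def etaX (Q : VField) (j : Jet1) : ℂ :=
  totalX (eta Q) j - j.2.1 * (totalX (xiT Q) j : ℝ) - j.2.2 * (totalX (xiX Q) j : ℝ)

/-- `η^tt = D_t η^t - ψ_tt D_t ξ^t - ψ_tx D_t ξ^x`. -/
def etaTT (Q : VField) (j : Jet2) : ℂ :=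
  totalT' (etaT Q) j - j.2.1 * (totalT (xiT Q) j.1 : ℝ) - j.2.2.1 * (totalT (xiX Q) j.1 : ℝ)

/-- `η^tx = D_x η^t - ψ_tt D_x ξ^t - ψ_tx D_x ξ^x`. -/
def etaTX (Q : VField) (j : Jet2) : ℂ :=
  totalX' (etaT Q) j - j.2.1 * (totalX (xiT Q) j.1 : ℝ) - j.2.2.1 * (totalX (xiX Q) j.1 : ℝ)

/-- `η^xx = D_x η^x - ψ_tx D_x ξ^t - ψ_xx D_x ξ^x`. -/
def etaXX (Q : VField) (j : Jet2) : ℂ :=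
  totalX' (etaX Q) j - j.2.2.1 * (totalX (xiT Q) j.1 : ℝ) - j.2.2.2 * (totalX (xiX Q) j.1 : ℝ)

/-- The second prolongation of `Q`, a vector field on the second-order jet space. -/
def pr2 (Q : VField) (j : Jet2) : Jet2 :=
  ((Q j.1.1, (etaT Q j.1, etaX Q j.1)), (etaTT Q j, etaTX Q j, etaXX Q j))

/-- The left-hand side `i ψ_t + ψ_xx + ψ² ψ* + V ψ` of the equation, as a function on the
second-order jet space. -/
def lhs (V : ℝ × ℝ → ℂ) (j : Jet2) : ℂ :=
  Complex.I * j.1.2.1 + j.2.2.2 + j.1.1.2.2 ^ 2 * (starRingEnd ℂ) j.1.1.2.2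
    + V (j.1.1.1, j.1.1.2.1) * j.1.1.2.2

/-- The maximal Lie invariance algebra of the equation with potential `V`, over the open set `W`
of the space of variables: all smooth vector fields on `W` whose second prolongation annihilates
the equation on the manifold it defines in the second-order jet space. -/
def maxAlg (V : ℝ × ℝ → ℂ) (W : Set Pt) : Set VField :=
  {Q | ContDiffOn ℝ ∞ Q W ∧
    ∀ j : Jet2, j.1.1 ∈ W → lhs V j = 0 → fderiv ℝ (lhs V) j (pr2 Q j) = 0}

/-- `∂_t`. -/
def opT : VField := fun _ => (1, 0, 0)
/-- `∂_x`. -/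
def opX : VField := fun _ => (0, 1, 0)
/-- `M = i (ψ ∂_ψ - ψ* ∂_ψ*)`. -/
def opM : VField := fun p => (0, 0, Complex.I * p.2.2)
/-- `I = ψ ∂_ψ + ψ* ∂_ψ*`. -/
def opI : VField := fun p => (0, 0, p.2.2)

/-- `D(ξ) = ξ ∂_t + ½ ξ_t x ∂_x + ⅛ ξ_tt x² M - ½ ξ_t I`. -/
def opD (ξ : ℝ → ℝ) : VField := fun p =>
  ξ p.1 • opT p + (1 / 2 * deriv ξ p.1 * p.2.1) • opX p
    + (1 / 8 * deriv (deriv ξ) p.1 * p.2.1 ^ 2) • opM p - (1 / 2 * deriv ξ p.1) • opI p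

/-- `G(χ) = χ ∂_x + ½ χ_t x M`. -/
def opG (χ : ℝ → ℝ) : VField := fun p =>
  χ p.1 • opX p + (1 / 2 * deriv χ p.1 * p.2.1) • opM p

/-- `λ M`, where `λ` is a function of `t`. -/
def opLM (l : ℝ → ℝ) : VField := fun p => l p.1 • opM p

/-- The linear span of the operators `D(ξ)`, `G(χ)`, `λ M`, where `ξ, χ, λ` run through the
real-valued functions of `t` that are smooth on `T`. -/
def opSpan (T : Set ℝ) : Submodule ℝ VField :=
  Submodule.span ℝ
    ({Q | ∃ ξ : ℝ → ℝ, ContDiffOn ℝ ∞ ξ T ∧ Q = opD ξ} ∪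
      {Q | ∃ χ : ℝ → ℝ, ContDiffOn ℝ ∞ χ T ∧ Q = opG χ} ∪
      {Q | ∃ l : ℝ → ℝ, ContDiffOn ℝ ∞ l T ∧ Q = opLM l})

section Partial

variable {E : Type} [NormedAddCommGroup E] [NormedSpace ℝ E]

/-- Partial derivative in `t` of a function of `(t, x, ψ, ψ*)`. -/
def partialT (F : Pt → E) (p : Pt) : E := fderiv ℝ F p (1, 0, 0)

/-- Partial derivative in `x` of a function of `(t, x, ψ, ψ*)`. -/
def partialX (F : Pt → E) (p : Pt) : E := fderiv ℝ F p (0, 1, 0)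

end Partial

/-- Partial derivative in `ψ` of a function of `(t, x, ψ, ψ*)`, that is the Wirtinger derivative
`½ (∂/∂(Re ψ) - i ∂/∂(Im ψ))`. -/
def partialPsi (F : Pt → ℂ) (p : Pt) : ℂ :=
  (1 / 2) * (fderiv ℝ F p (0, 0, 1) - Complex.I * fderiv ℝ F p (0, 0, Complex.I))

/-- The classifying condition `i η_ψt + η_ψxx + ξ^t V_t + ξ^x V_x + ξ^t_t V = 0` at `p`. -/
def Classifying (V : ℝ × ℝ → ℂ) (Q : VField) (p : Pt) : Prop :=
  Complex.I * partialT (partialPsi (eta Q)) p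
    + partialX (partialX (partialPsi (eta Q))) p
    + (xiT Q p : ℂ) * fderiv ℝ V (p.1, p.2.1) (1, 0)
    + (xiX Q p : ℂ) * fderiv ℝ V (p.1, p.2.1) (0, 1)
    + (partialT (xiT Q) p : ℝ) * V (p.1, p.2.1) = 0

end CubicSchrodinger

end

/-! The invariance condition is an identity in the free jet coordinates, with `ψ_t` eliminated by
the equation, and it is split coefficient by coefficient, each step simplifying the next. The
coefficient of `ψ_tx` makes `ξ^t` independent of `x` and `ψ` (`xiT_fiberwise_const`). The part
linear in `ψ_xx` gives `ξ^t_t = 2 ξ^x_x`, `ξ^x_ψ = 0` and the holomorphy of `η` in `ψ`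
(`determining_psiXX`). The powers of `ψ_x` give `η_ψψ = 0` and `2 η_ψx = i ξ^x_t`, plus a remainder
free of derivatives of `ψ` (`determining_psiX`). Hence locally `η = aψ + b` with `a`, `b`
independent of `ψ`, and the remainder is a cubic polynomial in `ψ`, `ψ*`. Its coefficients force `b
= 0`, `ξ^t_t + 2 Re a = 0` and the classifying condition (`determining_psi`). Integrating in `x`
leaves three arbitrary functions of `t`, namely `ξ`, `χ`, `λ`. They are well defined because the
sections of `W` over fixed `t` are connected. -/

namespace CubicSchrodinger

open Complex

/-! ### Directional derivatives on the space of variables -/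

section Calculus

variable {E : Type} [NormedAddCommGroup E] [NormedSpace ℝ E] {W : Set Pt} {f : Pt → E} {p : Pt}

/-- The derivative of `f` in the constant direction `v`. -/
noncomputable def dirDeriv (v : Pt) (f : Pt → E) : Pt → E := fun p => fderiv ℝ f p v

theorem differentiableAt_of_smooth (hW : IsOpen W) (hf : ContDiffOn ℝ ∞ f W) (hp : p ∈ W) :
    DifferentiableAt ℝ f p :=
  (hf.contDiffAt (hW.mem_nhds hp)).differentiableAt (by simp)

theorem smooth_fderiv (hW : IsOpen W) (hf : ContDiffOn ℝ ∞ f W) :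
    ContDiffOn ℝ ∞ (fderiv ℝ f) W :=
  hf.fderiv_of_isOpen hW (by simp)

theorem smooth_dirDeriv (hW : IsOpen W) (hf : ContDiffOn ℝ ∞ f W) (v : Pt) :
    ContDiffOn ℝ ∞ (dirDeriv v f) W :=
  (smooth_fderiv hW hf).clm_apply contDiffOn_const

theorem dirDeriv_dirDeriv (hW : IsOpen W) (hf : ContDiffOn ℝ ∞ f W) (hp : p ∈ W) (u v : Pt) :
    dirDeriv u (dirDeriv v f) p = fderiv ℝ (fderiv ℝ f) p u v := by
  have h := (differentiableAt_of_smooth hW (smooth_fderiv hW hf) hp).hasFDerivAt.clm_apply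
    (hasFDerivAt_const v p)
  unfold dirDeriv
  rw [h.fderiv]
  simp

theorem dirDeriv_comm (hW : IsOpen W) (hf : ContDiffOn ℝ ∞ f W) (hp : p ∈ W) (u v : Pt) :
    dirDeriv u (dirDeriv v f) p = dirDeriv v (dirDeriv u f) p := by
  rw [dirDeriv_dirDeriv hW hf hp, dirDeriv_dirDeriv hW hf hp]
  exact ((hf.contDiffAt (hW.mem_nhds hp)).isSymmSndFDerivAt
    (by simpa using WithTop.coe_le_coe.2 (le_top : (2 : ℕ∞) ≤ ⊤))) u v

theorem dirDeriv_congr (hW : IsOpen W) {g : Pt → E} (hfg : ∀ p ∈ W, f p = g p) (hp : p ∈ W)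
    (v : Pt) : dirDeriv v f p = dirDeriv v g p := by
  have h : f =ᶠ[nhds p] g := Filter.eventually_of_mem (hW.mem_nhds hp) hfg
  unfold dirDeriv
  rw [h.fderiv_eq]

theorem dirDeriv_eq_zero (hW : IsOpen W) (hf : ∀ p ∈ W, f p = 0) (hp : p ∈ W) (v : Pt) :
    dirDeriv v f p = 0 := by
  rw [dirDeriv_congr hW (g := fun _ => 0) hf hp]
  simp [dirDeriv]

theorem fderiv_totalX (hW : IsOpen W) (hf : ContDiffOn ℝ ∞ f W) {j : Jet1} (hj : j.1 ∈ W) :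
    DifferentiableAt ℝ (totalX f) j ∧ ∀ v : Jet1, fderiv ℝ (totalX f) j v =
      fderiv ℝ (fderiv ℝ f) j.1 v.1 (0, 1, j.2.2) + fderiv ℝ f j.1 (0, 0, v.2.2) := by
  have h1 : HasFDerivAt (fun j : Jet1 => fderiv ℝ f j.1) _ j :=
    (differentiableAt_of_smooth hW (smooth_fderiv hW hf) hj).hasFDerivAt.comp j
      (hasFDerivAt_fst (𝕜 := ℝ))
  have h2 : HasFDerivAt (fun j : Jet1 => ((0, 1, j.2.2) : Pt)) _ j :=
    (hasFDerivAt_const (0 : ℝ) j).prodMk ((hasFDerivAt_const (1 : ℝ) j).prodMk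
      ((hasFDerivAt_snd (𝕜 := ℝ)).comp j (hasFDerivAt_snd (𝕜 := ℝ))))
  have h := h1.clm_apply h2
  refine ⟨h.differentiableAt, fun v => ?_⟩
  change fderiv ℝ (fun j : Jet1 => (fderiv ℝ f j.1) ((0, 1, j.2.2) : Pt)) j v = _
  rw [h.fderiv]
  simp [add_comm]

end Calculus

/-! ### The prolongation formula and the invariance criterion -/

theorem fderiv_lhs {V : ℝ × ℝ → ℂ} {j : Jet2}
    (hV : DifferentiableAt ℝ V (j.1.1.1, j.1.1.2.1)) (v : Jet2) :
    fderiv ℝ (lhs V) j v = I * v.1.2.1 + v.2.2.2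
      + 2 * j.1.1.2.2 * (starRingEnd ℂ) j.1.1.2.2 * v.1.1.2.2
      + j.1.1.2.2 ^ 2 * (starRingEnd ℂ) v.1.1.2.2
      + V (j.1.1.1, j.1.1.2.1) * v.1.1.2.2
      + fderiv ℝ V (j.1.1.1, j.1.1.2.1) (v.1.1.1, v.1.1.2.1) * j.1.1.2.2 := by
  -- Writing the equation through linear coordinate projections lets the product rule apply
  -- directly.
  let jet : Jet2 →L[ℝ] Jet1 := ContinuousLinearMap.fst ℝ _ _
  let pt : Jet2 →L[ℝ] Pt := (ContinuousLinearMap.fst ℝ _ _).comp jet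
  let psi : Jet2 →L[ℝ] ℂ :=
    ((ContinuousLinearMap.snd ℝ _ _).comp (ContinuousLinearMap.snd ℝ _ _)).comp pt
  let psiT : Jet2 →L[ℝ] ℂ :=
    ((ContinuousLinearMap.fst ℝ _ _).comp (ContinuousLinearMap.snd ℝ _ _)).comp jet
  let psiXX : Jet2 →L[ℝ] ℂ :=
    ((ContinuousLinearMap.snd ℝ _ _).comp (ContinuousLinearMap.snd ℝ _ _)).comp
      (ContinuousLinearMap.snd ℝ _ _)
  let tx : Jet2 →L[ℝ] ℝ × ℝ := ((ContinuousLinearMap.fst ℝ _ _).comp pt).prod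
    (((ContinuousLinearMap.fst ℝ _ _).comp (ContinuousLinearMap.snd ℝ _ _)).comp pt)
  have hψ : HasFDerivAt (fun j : Jet2 => psi j) psi j := psi.hasFDerivAt
  have hc : HasFDerivAt (fun j : Jet2 => (starRingEnd ℂ) (psi j))
      ((conjCLE : ℂ →L[ℝ] ℂ).comp psi) j :=
    ((conjCLE : ℂ →L[ℝ] ℂ).comp psi).hasFDerivAt
  have hVtx : HasFDerivAt (fun j : Jet2 => V (tx j)) ((fderiv ℝ V (tx j)).comp tx) j :=
    HasFDerivAt.comp (x := j) (g := V) hV.hasFDerivAt tx.hasFDerivAt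
  have h := (((psiT.hasFDerivAt (x := j)).const_mul I).add (psiXX.hasFDerivAt (x := j))).add
    ((hψ.pow 2).mul hc) |>.add (hVtx.mul hψ)
  change fderiv ℝ (fun j => I * psiT j + psiXX j + (psi j) ^ 2 * (starRingEnd ℂ) (psi j)
    + V (tx j) * psi j) j v = _
  refine (congrArg (fun L => L v) h.fderiv).trans ?_
  simp [jet, pt, psi, psiT, psiXX, tx]
  ring

section Prolongation

variable {V : ℝ × ℝ → ℂ} {W : Set Pt} {Q : VField}

theorem smooth_xiT (h : ContDiffOn ℝ ∞ Q W) : ContDiffOn ℝ ∞ (xiT Q) W := h.fst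
theorem smooth_xiX (h : ContDiffOn ℝ ∞ Q W) : ContDiffOn ℝ ∞ (xiX Q) W := h.snd.fst
theorem smooth_eta (h : ContDiffOn ℝ ∞ Q W) : ContDiffOn ℝ ∞ (eta Q) W := h.snd.snd

/-- Differentiating the factors `ψ_t` and `ψ_x` of `η^x` yields second copies of `ψ_tx D_x ξ^t` and
`ψ_xx D_x ξ^x`; hence the two coefficients 2. -/
theorem etaXX_eq (hW : IsOpen W) (h : ContDiffOn ℝ ∞ Q W) {j : Jet2} (hj : j.1.1 ∈ W) :
    etaXX Q j = fderiv ℝ (fderiv ℝ (eta Q)) j.1.1 (0, 1, j.1.2.2) (0, 1, j.1.2.2)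
      + fderiv ℝ (eta Q) j.1.1 (0, 0, j.2.2.2)
      - j.1.2.1 * ((fderiv ℝ (fderiv ℝ (xiT Q)) j.1.1 (0, 1, j.1.2.2) (0, 1, j.1.2.2)
        + fderiv ℝ (xiT Q) j.1.1 (0, 0, j.2.2.2) : ℝ) : ℂ)
      - j.1.2.2 * ((fderiv ℝ (fderiv ℝ (xiX Q)) j.1.1 (0, 1, j.1.2.2) (0, 1, j.1.2.2)
        + fderiv ℝ (xiX Q) j.1.1 (0, 0, j.2.2.2) : ℝ) : ℂ)
      - 2 * j.2.2.1 * (fderiv ℝ (xiT Q) j.1.1 (0, 1, j.1.2.2) : ℝ)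
      - 2 * j.2.2.2 * (fderiv ℝ (xiX Q) j.1.1 (0, 1, j.1.2.2) : ℝ) := by
  obtain ⟨dE, hE⟩ := fderiv_totalX hW (smooth_eta h) hj
  obtain ⟨dT, hT⟩ := fderiv_totalX hW (smooth_xiT h) hj
  obtain ⟨dX, hX⟩ := fderiv_totalX hW (smooth_xiX h) hj
  have cT : HasFDerivAt (fun j : Jet1 => ((totalX (xiT Q) j : ℝ) : ℂ)) _ j.1 :=
    (ofRealCLM.hasFDerivAt).comp j.1 dT.hasFDerivAt
  have cX : HasFDerivAt (fun j : Jet1 => ((totalX (xiX Q) j : ℝ) : ℂ)) _ j.1 :=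
    (ofRealCLM.hasFDerivAt).comp j.1 dX.hasFDerivAt
  let a : Jet1 →L[ℝ] ℂ := (ContinuousLinearMap.fst ℝ _ _).comp (ContinuousLinearMap.snd ℝ _ _)
  let b : Jet1 →L[ℝ] ℂ := (ContinuousLinearMap.snd ℝ _ _).comp (ContinuousLinearMap.snd ℝ _ _)
  have H := (dE.hasFDerivAt.sub ((a.hasFDerivAt (x := j.1)).mul cT)).sub
    ((b.hasFDerivAt (x := j.1)).mul cX)
  have key : fderiv ℝ (etaX Q) j.1 ((0, 1, j.1.2.2), (j.2.2.1, j.2.2.2)) = _ :=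
    congrArg (fun L => L ((0, 1, j.1.2.2), (j.2.2.1, j.2.2.2))) H.fderiv
  unfold etaXX totalX'
  rw [key]
  simp [a, b, hE, hT, hX, totalX]
  ring

/-- The infinitesimal invariance criterion written out on the jet with derivatives
`ψ_t = w`, `ψ_x = q`, `ψ_tx = s`, `ψ_xx = r`. -/
theorem invariance_criterion (hW : IsOpen W) (hQ : Q ∈ maxAlg V W) {p : Pt} (hp : p ∈ W)
    (hV : DifferentiableAt ℝ V (p.1, p.2.1)) (w q s r : ℂ)
    (hj : I * w + r + p.2.2 ^ 2 * (starRingEnd ℂ) p.2.2 + V (p.1, p.2.1) * p.2.2 = 0) :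
    I * (fderiv ℝ (eta Q) p (1, 0, w) - w * (fderiv ℝ (xiT Q) p (1, 0, w) : ℝ)
        - q * (fderiv ℝ (xiX Q) p (1, 0, w) : ℝ))
      + (fderiv ℝ (fderiv ℝ (eta Q)) p (0, 1, q) (0, 1, q)
      + fderiv ℝ (eta Q) p (0, 0, r)
      - w * ((fderiv ℝ (fderiv ℝ (xiT Q)) p (0, 1, q) (0, 1, q)
        + fderiv ℝ (xiT Q) p (0, 0, r) : ℝ) : ℂ)
      - q * ((fderiv ℝ (fderiv ℝ (xiX Q)) p (0, 1, q) (0, 1, q)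
        + fderiv ℝ (xiX Q) p (0, 0, r) : ℝ) : ℂ)
      - 2 * s * (fderiv ℝ (xiT Q) p (0, 1, q) : ℝ)
      - 2 * r * (fderiv ℝ (xiX Q) p (0, 1, q) : ℝ))
      + 2 * p.2.2 * (starRingEnd ℂ) p.2.2 * eta Q p + p.2.2 ^ 2 * (starRingEnd ℂ) (eta Q p)
      + V (p.1, p.2.1) * eta Q p
      + fderiv ℝ V (p.1, p.2.1) (xiT Q p, xiX Q p) * p.2.2 = 0 := by
  -- `ψ_tt` enters neither the equation nor `η^t`, `η^xx`, so it is set to 0.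
  have h := hQ.2 ((p, (w, q)), (0, s, r)) hp (by simpa [lhs] using hj)
  rw [fderiv_lhs hV] at h
  simp only [pr2] at h
  rw [etaXX_eq hW hQ.1 hp] at h
  exact h

end Prolongation

/-! ### Splitting with respect to the derivatives of `ψ` -/

section Determining

theorem clm_split {E : Type} [NormedAddCommGroup E] [NormedSpace ℝ E] (A : Pt →L[ℝ] E)
    (a b : ℝ) (z : ℂ) :
    A (a, b, z) = a • A (1, 0, 0) + b • A (0, 1, 0) + A (0, 0, z) := by
  rw [← map_smul, ← map_smul, ← map_add, ← map_add]
  simp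

variable {V : ℝ × ℝ → ℂ} {W : Set Pt} {Q : VField} {p : Pt}

theorem xiT_fiberwise_const (hW : IsOpen W) (hV : ∀ p ∈ W, DifferentiableAt ℝ V (p.1, p.2.1))
    (hQ : Q ∈ maxAlg V W) (hp : p ∈ W) (x : ℝ) (z : ℂ) : dirDeriv (0, x, z) (xiT Q) p = 0 := by
  have key : ∀ q : ℂ, fderiv ℝ (xiT Q) p (0, 1, q) = 0 := by
    intro q
    set N := p.2.2 ^ 2 * (starRingEnd ℂ) p.2.2 + V (p.1, p.2.1) * p.2.2 with hN
    -- With `ψ_xx = 0` the equation is solved by `ψ_t = iN`, while `ψ_tx` stays free. Comparing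
    -- `ψ_tx = 0` with `ψ_tx = 1` isolates its coefficient `-2 D_x ξ^t`.
    have hj : I * (I * N) + 0 + p.2.2 ^ 2 * (starRingEnd ℂ) p.2.2 + V (p.1, p.2.1) * p.2.2 = 0 := by
      linear_combination N * I_sq - hN
    have h0 := invariance_criterion hW hQ hp (hV p hp) (I * N) q 0 0 hj
    have h1 := invariance_criterion hW hQ hp (hV p hp) (I * N) q 1 0 hj
    have h : ((fderiv ℝ (xiT Q) p (0, 1, q) : ℝ) : ℂ) = 0 := by
      linear_combination (h0 - h1) / 2
    exact_mod_cast h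
  unfold dirDeriv
  rw [clm_split]
  have h0 := key 0
  have h1 := key z
  rw [clm_split] at h1
  simp only [h0, smul_zero, zero_smul, zero_add, add_zero] at h1 ⊢
  exact h1

theorem xiT_snd_eq_zero (hW : IsOpen W) (hV : ∀ p ∈ W, DifferentiableAt ℝ V (p.1, p.2.1))
    (hQ : Q ∈ maxAlg V W) (hp : p ∈ W) (x : ℝ) (z : ℂ) (u : Pt) :
    fderiv ℝ (fderiv ℝ (xiT Q)) p u (0, x, z) = 0 := by
  rw [← dirDeriv_dirDeriv hW (smooth_xiT hQ.1) hp]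
  exact dirDeriv_eq_zero hW (fun p hp => xiT_fiberwise_const hW hV hQ hp x z) hp u

/-- The criterion after `ψ_t` has been expressed through `ψ_xx = r` by the equation. -/
theorem reduced_criterion (hW : IsOpen W) (hV : ∀ p ∈ W, DifferentiableAt ℝ V (p.1, p.2.1))
    (hQ : Q ∈ maxAlg V W) (hp : p ∈ W) {N : ℂ}
    (hN : N = p.2.2 ^ 2 * (starRingEnd ℂ) p.2.2 + V (p.1, p.2.1) * p.2.2) (q r : ℂ) :
    I * (fderiv ℝ (eta Q) p (1, 0, 0) + fderiv ℝ (eta Q) p (0, 0, I * (r + N))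
        - I * (r + N) * (fderiv ℝ (xiT Q) p (1, 0, 0) : ℝ)
        - q * ((fderiv ℝ (xiX Q) p (1, 0, 0) + fderiv ℝ (xiX Q) p (0, 0, I * (r + N)) : ℝ) : ℂ))
      + (fderiv ℝ (fderiv ℝ (eta Q)) p (0, 1, q) (0, 1, q)
      + fderiv ℝ (eta Q) p (0, 0, r)
      - q * ((fderiv ℝ (fderiv ℝ (xiX Q)) p (0, 1, q) (0, 1, q)
        + fderiv ℝ (xiX Q) p (0, 0, r) : ℝ) : ℂ)
      - 2 * r * ((fderiv ℝ (xiX Q) p (0, 1, 0) + fderiv ℝ (xiX Q) p (0, 0, q) : ℝ) : ℂ))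
      + 2 * p.2.2 * (starRingEnd ℂ) p.2.2 * eta Q p + p.2.2 ^ 2 * (starRingEnd ℂ) (eta Q p)
      + V (p.1, p.2.1) * eta Q p
      + fderiv ℝ V (p.1, p.2.1) (xiT Q p, xiX Q p) * p.2.2 = 0 := by
  have h := invariance_criterion hW hQ hp (hV p hp) (I * (r + N)) q 0 r
    (by linear_combination (r + N) * I_sq - hN)
  have hT : ∀ (x : ℝ) (z : ℂ), fderiv ℝ (xiT Q) p (0, x, z) = 0 :=
    fun x z => xiT_fiberwise_const hW hV hQ hp x z
  rw [clm_split (fderiv ℝ (eta Q) p) 1 0, clm_split (fderiv ℝ (xiT Q) p) 1 0,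
    clm_split (fderiv ℝ (xiX Q) p) 1 0, clm_split (fderiv ℝ (xiX Q) p) 0 1 q,
    xiT_snd_eq_zero hW hV hQ hp] at h
  simp only [hT, one_smul, zero_smul, add_zero, zero_add, ofReal_zero, ofReal_add] at h ⊢
  linear_combination h

theorem clm_complex (A : Pt →L[ℝ] ℂ) (z : ℂ) :
    A (0, 0, z) = z.re * A (0, 0, 1) + z.im * A (0, 0, I) := by
  rw [← real_smul, ← real_smul, ← map_smul, ← map_smul, ← map_add]
  simp

theorem clm_real (A : Pt →L[ℝ] ℝ) (z : ℂ) :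
    A (0, 0, z) = z.re * A (0, 0, 1) + z.im * A (0, 0, I) := by
  rw [← smul_eq_mul, ← smul_eq_mul, ← map_smul, ← map_smul, ← map_add]
  simp

theorem determining_psiXX (hW : IsOpen W) (hV : ∀ p ∈ W, DifferentiableAt ℝ V (p.1, p.2.1))
    (hQ : Q ∈ maxAlg V W) (hp : p ∈ W) :
    fderiv ℝ (xiT Q) p (1, 0, 0) = 2 * fderiv ℝ (xiX Q) p (0, 1, 0) ∧
    (∀ z, fderiv ℝ (eta Q) p (0, 0, z) = z * fderiv ℝ (eta Q) p (0, 0, 1)) ∧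
    ∀ z, fderiv ℝ (xiX Q) p (0, 0, z) = 0 := by
  set N := p.2.2 ^ 2 * (starRingEnd ℂ) p.2.2 + V (p.1, p.2.1) * p.2.2 with hN
  -- The part linear in `r = ψ_xx`, obtained by subtracting the criterion at `r = 0`.
  have key : ∀ q r : ℂ, I * fderiv ℝ (eta Q) p (0, 0, I * r)
      + r * (fderiv ℝ (xiT Q) p (1, 0, 0) : ℝ)
      - I * q * (fderiv ℝ (xiX Q) p (0, 0, I * r) : ℝ)
      + fderiv ℝ (eta Q) p (0, 0, r) - q * (fderiv ℝ (xiX Q) p (0, 0, r) : ℝ)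
      - 2 * r * ((fderiv ℝ (xiX Q) p (0, 1, 0) + fderiv ℝ (xiX Q) p (0, 0, q) : ℝ) : ℂ) = 0 := by
    intro q r
    have h := reduced_criterion hW hV hQ hp hN q r
    have h0 := reduced_criterion hW hV hQ hp hN q 0
    have e : ((0, 0, I * (r + N)) : Pt) = (0, 0, I * r) + (0, 0, I * (0 + N)) := by
      simp [mul_add]
    have e0 : ((0, 0, 0) : Pt) = 0 := rfl
    rw [e] at h
    simp only [map_add, e0, map_zero, ofReal_add, ofReal_zero] at h h0 ⊢
    linear_combination h - h0 + r * (fderiv ℝ (xiT Q) p (1, 0, 0) : ℝ) * I_sq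
  have e0 : ((0, 0, 0) : Pt) = 0 := rfl
  have k1 := key 0 1
  have kI := key 0 I
  have k11 := key 1 1
  have kII := key I I
  have em : fderiv ℝ (eta Q) p (0, 0, -1) = - fderiv ℝ (eta Q) p (0, 0, 1) := by
    rw [← map_neg]; simp
  have em' : fderiv ℝ (xiX Q) p (0, 0, -1) = - fderiv ℝ (xiX Q) p (0, 0, 1) := by
    rw [← map_neg]; simp
  simp only [mul_one, I_mul_I, em, em', e0, map_zero, ofReal_add, ofReal_zero, ofReal_neg]
    at k1 kI k11 kII
  -- The Cauchy–Riemann equation for `η` in `ψ`, from comparing `r = 1` with `r = i` at `q = 0`.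
  have hI : fderiv ℝ (eta Q) p (0, 0, I) = I * fderiv ℝ (eta Q) p (0, 0, 1) := by
    linear_combination (kI - I * k1) / 2 + fderiv ℝ (eta Q) p (0, 0, I) / 2 * I_sq
  refine ⟨?_, fun z => ?_, fun z => ?_⟩
  · have : ((fderiv ℝ (xiT Q) p (1, 0, 0) : ℝ) : ℂ) = (2 * fderiv ℝ (xiX Q) p (0, 1, 0) : ℝ) := by
      push_cast
      linear_combination k1 - I * hI - fderiv ℝ (eta Q) p (0, 0, 1) * I_sq
    exact_mod_cast this
  · rw [clm_complex, hI]
    nth_rewrite 3 [← re_add_im z]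
    ring
  -- The difference of the cases `q = 1` and `q = 0` at `r = 1` is `-3 ∂ξ^x/∂(Re ψ) - i ∂ξ^x/∂(Im
  -- ψ)`; as `ξ^x` is real, both terms vanish.
  · have r1 := congrArg re (sub_eq_zero.2 (k11.trans k1.symm))
    have r2 := congrArg im (sub_eq_zero.2 (k11.trans k1.symm))
    simp at r1 r2
    rw [clm_real]
    have a1 : fderiv ℝ (xiX Q) p (0, 0, 1) = 0 := by linarith
    have a2 : fderiv ℝ (xiX Q) p (0, 0, I) = 0 := by linarith
    rw [a1, a2]; ring

theorem determining_psiX (hW : IsOpen W) (hV : ∀ p ∈ W, DifferentiableAt ℝ V (p.1, p.2.1))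
    (hQ : Q ∈ maxAlg V W) (hp : p ∈ W) :
    dirDeriv (0, 0, 1) (dirDeriv (0, 0, 1) (eta Q)) p = 0 ∧
    2 * dirDeriv (0, 1, 0) (dirDeriv (0, 0, 1) (eta Q)) p
      = I * (dirDeriv (1, 0, 0) (xiX Q) p : ℝ) ∧
    I * dirDeriv (1, 0, 0) (eta Q) p + dirDeriv (0, 1, 0) (dirDeriv (0, 1, 0) (eta Q)) p
      + ((dirDeriv (1, 0, 0) (xiT Q) p : ℝ) - dirDeriv (0, 0, 1) (eta Q) p)
        * (p.2.2 ^ 2 * (starRingEnd ℂ) p.2.2 + V (p.1, p.2.1) * p.2.2)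
      + 2 * p.2.2 * (starRingEnd ℂ) p.2.2 * eta Q p + p.2.2 ^ 2 * (starRingEnd ℂ) (eta Q p)
      + V (p.1, p.2.1) * eta Q p
      + fderiv ℝ V (p.1, p.2.1) (xiT Q p, xiX Q p) * p.2.2 = 0 := by
  have hη := smooth_eta hQ.1
  have hX := smooth_xiX hQ.1
  set N := p.2.2 ^ 2 * (starRingEnd ℂ) p.2.2 + V (p.1, p.2.1) * p.2.2 with hN
  have hη2 : ∀ u z, fderiv ℝ (fderiv ℝ (eta Q)) p u (0, 0, z)
      = z * fderiv ℝ (fderiv ℝ (eta Q)) p u (0, 0, 1) := by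
    intro u z
    rw [← dirDeriv_dirDeriv hW hη hp, ← dirDeriv_dirDeriv hW hη hp,
      dirDeriv_congr hW (f := dirDeriv (0, 0, z) (eta Q))
        (g := fun p => z * dirDeriv (0, 0, 1) (eta Q) p)
        (fun p hp => (determining_psiXX hW hV hQ hp).2.1 z) hp]
    have hd := differentiableAt_of_smooth hW (smooth_dirDeriv hW hη (0, 0, 1)) hp
    have := congrArg (fun L => L u) (hd.hasFDerivAt.const_mul z).fderiv
    exact this
  have hsymm : ∀ u v, fderiv ℝ (fderiv ℝ (eta Q)) p u v = fderiv ℝ (fderiv ℝ (eta Q)) p v u := by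
    intro u v
    rw [← dirDeriv_dirDeriv hW hη hp, dirDeriv_comm hW hη hp, dirDeriv_dirDeriv hW hη hp]
  -- `ξ^x_x = ½ ξ^t_t` and `ξ^x_ψ = 0`, so a further derivative along `(0, 1, q)` falls on `ξ^t_t`,
  -- where it vanishes.
  have hX2 : ∀ q, fderiv ℝ (fderiv ℝ (xiX Q)) p (0, 1, q) (0, 1, q) = 0 := by
    intro q
    rw [← dirDeriv_dirDeriv hW hX hp, dirDeriv_congr hW
      (g := fun p => (1 / 2 : ℝ) * dirDeriv (1, 0, 0) (xiT Q) p) (fun p hp => ?_) hp]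
    · have hd := differentiableAt_of_smooth hW
        (smooth_dirDeriv hW (smooth_xiT hQ.1) (1, 0, 0)) hp
      have := congrArg (fun L => L (0, 1, q)) (hd.hasFDerivAt.const_mul (1 / 2 : ℝ)).fderiv
      refine this.trans ?_
      have h2 := dirDeriv_comm hW (smooth_xiT hQ.1) hp (0, 1, q) (1, 0, 0)
      rw [dirDeriv_eq_zero hW (fun p hp => xiT_fiberwise_const hW hV hQ hp 1 q) hp] at h2
      change (1 / 2 : ℝ) * dirDeriv (0, 1, q) (dirDeriv (1, 0, 0) (xiT Q)) p = 0
      rw [h2, mul_zero]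
    · unfold dirDeriv
      rw [clm_split, (determining_psiXX hW hV hQ hp).2.2, (determining_psiXX hW hV hQ hp).1]
      simp
  have hη22 : ∀ q, fderiv ℝ (fderiv ℝ (eta Q)) p (0, 1, q) (0, 1, q)
      = fderiv ℝ (fderiv ℝ (eta Q)) p (0, 1, 0) (0, 1, 0)
        + 2 * q * fderiv ℝ (fderiv ℝ (eta Q)) p (0, 1, 0) (0, 0, 1)
        + q ^ 2 * fderiv ℝ (fderiv ℝ (eta Q)) p (0, 0, 1) (0, 0, 1) := by
    intro q
    have e : ((0, 1, q) : Pt) = (0, 1, 0) + (0, 0, q) := by simp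
    rw [e, map_add, map_add, add_apply, add_apply,
      hsymm (0, 0, q) (0, 1, 0), hη2 (0, 1, 0) q, hη2 (0, 0, q) q, hsymm (0, 0, q) (0, 0, 1),
      hη2 (0, 0, 1) q]
    ring
  obtain ⟨-, hlin, hX0⟩ := determining_psiXX hW hV hQ hp
  have e0 : fderiv ℝ (eta Q) p (0, 0, 0) = 0 := map_zero _
  have key : ∀ q : ℂ, I * (dirDeriv (1, 0, 0) (eta Q) p + I * N * dirDeriv (0, 0, 1) (eta Q) p
        - I * N * (dirDeriv (1, 0, 0) (xiT Q) p : ℝ) - q * (dirDeriv (1, 0, 0) (xiX Q) p : ℝ))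
      + (fderiv ℝ (fderiv ℝ (eta Q)) p (0, 1, 0) (0, 1, 0)
        + 2 * q * fderiv ℝ (fderiv ℝ (eta Q)) p (0, 1, 0) (0, 0, 1)
        + q ^ 2 * fderiv ℝ (fderiv ℝ (eta Q)) p (0, 0, 1) (0, 0, 1))
      + 2 * p.2.2 * (starRingEnd ℂ) p.2.2 * eta Q p + p.2.2 ^ 2 * (starRingEnd ℂ) (eta Q p)
      + V (p.1, p.2.1) * eta Q p
      + fderiv ℝ V (p.1, p.2.1) (xiT Q p, xiX Q p) * p.2.2 = 0 := by
    intro q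
    have h := reduced_criterion hW hV hQ hp hN q 0
    rw [hη22 q, hX2, hlin (I * (0 + N)), hX0, hX0, hX0, e0] at h
    simp only [zero_add, add_zero, ofReal_zero] at h
    unfold dirDeriv
    linear_combination h
  -- A quadratic polynomial in `q = ψ_x` vanishes identically; its values at 0, 1, -1 recover the
  -- coefficients.
  have k0 := key 0
  have k1 := key 1
  have k2 := key (-1)
  refine ⟨?_, ?_, ?_⟩
  · rw [dirDeriv_dirDeriv hW hη hp]
    linear_combination (k1 + k2) / 2 - k0
  · rw [dirDeriv_dirDeriv hW hη hp]
    linear_combination (k1 - k2) / 2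
  · rw [dirDeriv_dirDeriv hW hη hp]
    linear_combination k0 + N * ((dirDeriv (1, 0, 0) (xiT Q) p : ℝ)
      - dirDeriv (0, 0, 1) (eta Q) p) * I_sq

end Determining

/-! ### Constancy and affinity along fibers -/

section Fibers

variable {E : Type} [NormedAddCommGroup E] [NormedSpace ℝ E] {W : Set Pt}

theorem const_along {F : Type} [NormedAddCommGroup F] [NormedSpace ℝ F] (hW : IsOpen W)
    {f : Pt → E} (hf : ContDiffOn ℝ ∞ f W) {s : Set F} (hs : IsOpen s) (hc : IsPreconnected s)
    {g : F → Pt} {L : F →L[ℝ] Pt} (hg : ∀ y, HasFDerivAt g L y) (hgs : ∀ y ∈ s, g y ∈ W)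
    (h0 : ∀ p ∈ W, ∀ v, dirDeriv (L v) f p = 0) {y z : F} (hy : y ∈ s) (hz : z ∈ s) :
    f (g y) = f (g z) := by
  have hd : ∀ y ∈ s, HasFDerivAt (f ∘ g) ((fderiv ℝ f (g y)).comp L) y := fun y hy =>
    (differentiableAt_of_smooth hW hf (hgs y hy)).hasFDerivAt.comp y (hg y)
  refine hs.is_const_of_fderiv_eq_zero (𝕜 := ℝ) (f := f ∘ g) hc
    (fun y hy => (hd y hy).differentiableAt.differentiableWithinAt) (fun y hy => ?_) hy hz
  rw [(hd y hy).fderiv]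
  ext v
  exact h0 _ (hgs y hy) v

theorem const_on_section (hW : IsOpen W) {f : Pt → E} (hf : ContDiffOn ℝ ∞ f W)
    (hsec : ∀ t : ℝ, IsPreconnected {q : ℝ × ℂ | (t, q) ∈ W})
    (h0 : ∀ p ∈ W, ∀ (x : ℝ) (z : ℂ), dirDeriv (0, x, z) f p = 0) {t : ℝ} {q q' : ℝ × ℂ}
    (hq : (t, q) ∈ W) (hq' : (t, q') ∈ W) : f (t, q) = f (t, q') :=
  const_along hW hf (hW.preimage (Continuous.prodMk_right t)) (hsec t)
    (fun y => hasFDerivAt_prodMk_right t y) (fun _ h => h) (fun p hp v => h0 p hp v.1 v.2) hq hq'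

/-- Only the `(x, ψ)`-sections are assumed connected, not the `ψ`-fibers over fixed `(t, x)`, so
arguments in `ψ` alone are confined to a ball. -/
theorem const_on_ball (hW : IsOpen W) {f : Pt → E} (hf : ContDiffOn ℝ ∞ f W)
    (h0 : ∀ p ∈ W, ∀ z : ℂ, dirDeriv (0, 0, z) f p = 0) {t x : ℝ} {c z : ℂ} {ε : ℝ}
    (hball : ∀ w ∈ Metric.ball c ε, (t, x, w) ∈ W) (hz : z ∈ Metric.ball c ε) :
    f (t, x, z) = f (t, x, c) := by
  have hε : c ∈ Metric.ball c ε := Metric.mem_ball_self (Metric.pos_of_mem_ball hz)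
  have hg : ∀ y : ℂ, HasFDerivAt (fun y : ℂ => ((t, x, y) : Pt)) _ y := fun y =>
    (hasFDerivAt_prodMk_right (𝕜 := ℝ) t (x, y)).comp y (hasFDerivAt_prodMk_right (𝕜 := ℝ) x y)
  exact const_along hW hf Metric.isOpen_ball (convex_ball c ε).isPreconnected hg hball
    (fun p hp v => h0 p hp v) hz hε

/-- `f` is locally affine in `ψ` and does not depend on `ψ*`, with slope `a`. -/
def FiberAffine (W : Set Pt) (f a : Pt → ℂ) : Prop :=
  ∀ p ∈ W, ∀ z : ℂ, dirDeriv (0, 0, z) f p = z * a p ∧ dirDeriv (0, 0, z) a p = 0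

theorem dirDeriv_const_mul (hW : IsOpen W) {a : Pt → ℂ} (ha : ContDiffOn ℝ ∞ a W) {p : Pt}
    (hp : p ∈ W) (z : ℂ) (v : Pt) : dirDeriv v (fun p => z * a p) p = z * dirDeriv v a p :=
  congrArg (fun L => L v)
    ((differentiableAt_of_smooth hW ha hp).hasFDerivAt.const_mul z).fderiv

theorem FiberAffine.dirDeriv (hW : IsOpen W) {f a : Pt → ℂ} (hf : ContDiffOn ℝ ∞ f W)
    (ha : ContDiffOn ℝ ∞ a W) (h : FiberAffine W f a) (v : Pt) :
    FiberAffine W (dirDeriv v f) (dirDeriv v a) := by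
  intro p hp z
  rw [dirDeriv_comm hW hf hp, dirDeriv_comm hW ha hp]
  refine ⟨?_, dirDeriv_eq_zero hW (fun p hp => (h p hp z).2) hp v⟩
  rw [dirDeriv_congr hW (g := fun p => z * a p) (fun p hp => (h p hp z).1) hp]
  exact dirDeriv_const_mul hW ha hp z v

theorem FiberAffine.eq_add (hW : IsOpen W) {f a : Pt → ℂ} (hf : ContDiffOn ℝ ∞ f W)
    (ha : ContDiffOn ℝ ∞ a W) (h : FiberAffine W f a) {t x : ℝ} {c z : ℂ} {ε : ℝ}
    (hball : ∀ w ∈ Metric.ball c ε, (t, x, w) ∈ W) (hz : z ∈ Metric.ball c ε) :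
    f (t, x, z) = f (t, x, c) + (z - c) * a (t, x, c) := by
  have h1 : a (t, x, z) = a (t, x, c) := const_on_ball hW ha (fun p hp z => (h p hp z).2) hball hz
  have hψ : ContDiffOn ℝ ∞ (fun p : Pt => p.2.2) W := (contDiff_snd.comp contDiff_snd).contDiffOn
  -- `f - ψ a` has zero derivative along the fiber, hence is constant on the ball.
  have h2 := const_on_ball hW (f := fun p => f p - p.2.2 * a p) (hf.sub (hψ.mul ha))
    (fun p hp z => ?_) hball hz
  · simp only at h2
    rw [h1] at h2
    linear_combination h2
  · have hψ' : HasFDerivAt (fun p : Pt => p.2.2) _ p :=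
      (hasFDerivAt_snd (𝕜 := ℝ)).comp p (hasFDerivAt_snd (𝕜 := ℝ))
    have hd := (differentiableAt_of_smooth hW hf hp).hasFDerivAt.sub
      (hψ'.mul (differentiableAt_of_smooth hW ha hp).hasFDerivAt)
    refine (congrArg (fun L => L (0, 0, z)) hd.fderiv).trans ?_
    have e1 : fderiv ℝ f p (0, 0, z) = z * a p := (h p hp z).1
    have e2 : fderiv ℝ a p (0, 0, z) = 0 := (h p hp z).2
    simp [e1, e2]
    ring

end Fibers

/-! ### Splitting with respect to `ψ` -/

theorem cubic_coeff_eq_zero {ε : ℝ} (hε : 0 < ε) {c₀ c₁ c₂ c₃ : ℂ}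
    (h : ∀ s : ℝ, |s| < ε → c₀ + c₁ * s + c₂ * s ^ 2 + c₃ * s ^ 3 = 0) :
    c₁ = 0 ∧ c₂ = 0 ∧ c₃ = 0 := by
  -- Finite differences at `0, ±d, ±2d` with `d = ε/4`, which keeps `2d < ε`.
  have hd : ((ε / 4 : ℝ) : ℂ) ≠ 0 := by exact_mod_cast (by positivity : ε / 4 ≠ 0)
  have h0 := h 0 (by simpa)
  have h1 := h (ε / 4) (by rw [abs_of_pos (by positivity)]; linarith)
  have h2 := h (-(ε / 4)) (by rw [abs_neg, abs_of_pos (by positivity)]; linarith)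
  have h3 := h (2 * (ε / 4)) (by rw [abs_of_pos (by positivity)]; linarith)
  have h4 := h (-(2 * (ε / 4))) (by rw [abs_neg, abs_of_pos (by positivity)]; linarith)
  generalize ε / 4 = d at *
  push_cast at h0 h1 h2 h3 h4
  refine ⟨?_, ?_, ?_⟩
  · apply mul_left_cancel₀ hd
    linear_combination (2 / 3) * (h1 - h2) - (h3 - h4) / 12
  · apply mul_left_cancel₀ (pow_ne_zero 2 hd)
    linear_combination (h1 + h2) / 2 - h0
  · apply mul_left_cancel₀ (pow_ne_zero 3 hd)
    linear_combination (h3 - h4) / 12 - (h1 - h2) / 6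

section Determining

variable {V : ℝ × ℝ → ℂ} {W : Set Pt} {Q : VField} {p : Pt}

theorem fiberAffine_eta (hW : IsOpen W) (hV : ∀ p ∈ W, DifferentiableAt ℝ V (p.1, p.2.1))
    (hQ : Q ∈ maxAlg V W) : FiberAffine W (eta Q) (dirDeriv (0, 0, 1) (eta Q)) := by
  have hη := smooth_eta hQ.1
  refine fun p hp z => ⟨(determining_psiXX hW hV hQ hp).2.1 z, ?_⟩
  rw [dirDeriv_comm hW hη hp, dirDeriv_congr hW (f := dirDeriv (0, 0, z) (eta Q))
    (g := fun p => z * dirDeriv (0, 0, 1) (eta Q) p)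
    (fun p hp => (determining_psiXX hW hV hQ hp).2.1 z) hp,
    dirDeriv_const_mul hW (smooth_dirDeriv hW hη _) hp, (determining_psiX hW hV hQ hp).1, mul_zero]

theorem determining_psi (hW : IsOpen W) (hV : ∀ p ∈ W, DifferentiableAt ℝ V (p.1, p.2.1))
    (hQ : Q ∈ maxAlg V W) (hp : p ∈ W) :
    (dirDeriv (1, 0, 0) (xiT Q) p : ℝ) + dirDeriv (0, 0, 1) (eta Q) p
      + (starRingEnd ℂ) (dirDeriv (0, 0, 1) (eta Q) p) = 0 ∧
    eta Q p = dirDeriv (0, 0, 1) (eta Q) p * p.2.2 ∧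
    I * dirDeriv (1, 0, 0) (dirDeriv (0, 0, 1) (eta Q)) p
      + dirDeriv (0, 1, 0) (dirDeriv (0, 1, 0) (dirDeriv (0, 0, 1) (eta Q))) p
      + fderiv ℝ V (p.1, p.2.1) (xiT Q p, xiX Q p)
      + (dirDeriv (1, 0, 0) (xiT Q) p : ℝ) * V (p.1, p.2.1) = 0 := by
  have hT := smooth_xiT hQ.1
  have hX := smooth_xiX hQ.1
  have hη := smooth_eta hQ.1
  have ha := smooth_dirDeriv hW hη (0, 0, 1)
  have hA := fiberAffine_eta hW hV hQ
  have hAt := hA.dirDeriv hW hη ha (1, 0, 0)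
  have hAx := hA.dirDeriv hW hη ha (0, 1, 0)
  have hAxx := hAx.dirDeriv hW (smooth_dirDeriv hW hη _) (smooth_dirDeriv hW ha _) (0, 1, 0)
  have hT0 : ∀ p ∈ W, ∀ z : ℂ, dirDeriv (0, 0, z) (xiT Q) p = 0 :=
    fun p hp z => xiT_fiberwise_const hW hV hQ hp 0 z
  have hTt0 : ∀ p ∈ W, ∀ z : ℂ, dirDeriv (0, 0, z) (dirDeriv (1, 0, 0) (xiT Q)) p = 0 := by
    intro p hp z
    rw [dirDeriv_comm hW hT hp]
    exact dirDeriv_eq_zero hW (fun p hp => hT0 p hp z) hp _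
  have hX0 : ∀ p ∈ W, ∀ z : ℂ, dirDeriv (0, 0, z) (xiX Q) p = 0 :=
    fun p hp z => (determining_psiXX hW hV hQ hp).2.2 z
  obtain ⟨t, x, c⟩ := p
  obtain ⟨ε, hε, hball⟩ : ∃ ε > 0, ∀ w ∈ Metric.ball c ε, (t, x, w) ∈ W :=
    Metric.isOpen_iff.1 (hW.preimage (by fun_prop : Continuous fun w : ℂ => ((t, x, w) : Pt))) c hp
  -- Real shifts `ψ = c + s` suffice: conjugation fixes `s`, so the remainder becomes a cubic
  -- polynomial in `s`.
  have key : ∀ s : ℝ, |s| < ε → _ := fun s hs => by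
    have hz : c + s ∈ Metric.ball c ε := by simpa using hs
    have h := (determining_psiX hW hV hQ (hball _ hz)).2.2
    rw [hA.eq_add hW hη ha hball hz, const_on_ball hW ha (fun p hp z => (hA p hp z).2) hball hz,
      hAt.eq_add hW (smooth_dirDeriv hW hη _) (smooth_dirDeriv hW ha _) hball hz,
      hAxx.eq_add hW (smooth_dirDeriv hW (smooth_dirDeriv hW hη _) _)
        (smooth_dirDeriv hW (smooth_dirDeriv hW ha _) _) hball hz,
      const_on_ball hW hT hT0 hball hz, const_on_ball hW hX hX0 hball hz,
      const_on_ball hW (smooth_dirDeriv hW hT _) hTt0 hball hz] at h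
    exact h
  simp only at key ⊢
  generalize dirDeriv (1, 0, 0) (dirDeriv (0, 0, 1) (eta Q)) (t, x, c) = at' at *
  generalize dirDeriv (0, 1, 0) (dirDeriv (0, 1, 0) (dirDeriv (0, 0, 1) (eta Q))) (t, x, c)
    = axx at *
  generalize dirDeriv (0, 0, 1) (eta Q) (t, x, c) = a at *
  generalize eta Q (t, x, c) = e at *
  generalize dirDeriv (1, 0, 0) (eta Q) (t, x, c) = et at *
  generalize dirDeriv (0, 1, 0) (dirDeriv (0, 1, 0) (eta Q)) (t, x, c) = exx at *
  generalize dirDeriv (1, 0, 0) (xiT Q) (t, x, c) = τ at *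
  generalize fderiv ℝ V (t, x) (xiT Q (t, x, c), xiX Q (t, x, c)) = D at *
  generalize V (t, x) = v at *
  simp only [map_add, map_mul, add_sub_cancel_left, conj_ofReal] at key
  set c' := (starRingEnd ℂ) c with hc'
  set a' := (starRingEnd ℂ) a with ha'
  set e' := (starRingEnd ℂ) e with he'
  obtain ⟨h1, h2, h3⟩ := cubic_coeff_eq_zero hε
    (c₀ := I * et + exx + (τ - a) * (c ^ 2 * c' + v * c) + 2 * c * c' * e + c ^ 2 * e' + v * e
      + D * c)
    (c₁ := I * at' + axx + (τ - a) * (c ^ 2 + 2 * c * c' + v) + 2 * e * (c + c') + 2 * c * c' * a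
      + 2 * c * e' + c ^ 2 * a' + v * a + D)
    (c₂ := (τ - a) * (2 * c + c') + 2 * (e + a * (c + c')) + e' + 2 * c * a')
    (c₃ := τ + a + a') (fun s hs => by linear_combination key s hs)
  -- With `b = η - aψ`, the quadratic coefficient reduces to `2b + b* = 0`. Together with its
  -- conjugate this gives `b = 0`.
  have hb : 2 * (e - a * c) + (e' - a' * c') = 0 := by
    linear_combination h2 - (2 * c + c') * h3
  have hb' : 2 * (e' - a' * c') + (e - a * c) = 0 := by
    have := congrArg (starRingEnd ℂ) hb
    simpa [c', a', e', map_ofNat] using this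
  have he : e = a * c := by linear_combination (2 / 3) * hb - hb' / 3
  refine ⟨h3, he, ?_⟩
  have he2 : e' = a' * c' := by linear_combination hb - 2 * he
  rw [he, he2] at h1
  linear_combination h1 - (c ^ 2 + 2 * c * c') * h3

theorem classifying (hW : IsOpen W) (hV : ∀ p ∈ W, DifferentiableAt ℝ V (p.1, p.2.1))
    (hQ : Q ∈ maxAlg V W) (hp : p ∈ W) : Classifying V Q p := by
  -- Since `η` is holomorphic in `ψ`, its Wirtinger derivative is the derivative in the real
  -- direction.
  have hψ : ∀ p ∈ W, partialPsi (eta Q) p = dirDeriv (0, 0, 1) (eta Q) p := by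
    intro p hp
    unfold partialPsi dirDeriv
    rw [(determining_psiXX hW hV hQ hp).2.1 I]
    linear_combination -fderiv ℝ (eta Q) p (0, 0, 1) / 2 * I_sq
  have h := (determining_psi hW hV hQ hp).2.2
  rw [← dirDeriv_congr hW hψ hp, ← dirDeriv_congr hW
    (fun p hp => dirDeriv_congr hW hψ hp (0, 1, 0)) hp] at h
  have e : fderiv ℝ V (p.1, p.2.1) (xiT Q p, xiX Q p)
      = (xiT Q p : ℂ) * fderiv ℝ V (p.1, p.2.1) (1, 0)
        + (xiX Q p : ℂ) * fderiv ℝ V (p.1, p.2.1) (0, 1) := by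
    rw [← real_smul, ← real_smul, ← map_smul, ← map_smul, ← map_add]
    simp
  rw [e, ← add_assoc] at h
  exact h

end Determining

/-! ### Functions of `t` alone and integration of the determining equations -/

section TimeFunctions

variable {W : Set Pt}

/-- Connectedness makes the value of `f` on a section independent of the chosen point. For
smoothness near `t` a single `q` is kept fixed, since `(s, q)` stays in the open set `W` for `s`
close to `t`. -/
theorem exists_time_function (hW : IsOpen W) {f : Pt → ℝ} (hf : ContDiffOn ℝ ∞ f W)
    (hsec : ∀ t : ℝ, IsPreconnected {q : ℝ × ℂ | (t, q) ∈ W})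
    (h0 : ∀ p ∈ W, ∀ (x : ℝ) (z : ℂ), dirDeriv (0, x, z) f p = 0) :
    ∃ φ : ℝ → ℝ, ContDiffOn ℝ ∞ φ (Prod.fst '' W) ∧ ∀ p ∈ W, f p = φ p.1 := by
  classical
  let φ : ℝ → ℝ := fun t => if h : ∃ q, (t, q) ∈ W then f (t, h.choose) else 0
  have hφ : ∀ p ∈ W, f p = φ p.1 := by
    rintro ⟨t, q⟩ hp
    have h : ∃ q, (t, q) ∈ W := ⟨q, hp⟩
    simp only [φ, dif_pos h]
    exact const_on_section hW hf hsec h0 hp h.choose_spec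
  refine ⟨φ, ?_, hφ⟩
  rintro _ ⟨⟨t, q⟩, hp, rfl⟩
  have hcont : ContDiff ℝ ∞ fun s : ℝ => (s, q) := contDiff_id.prodMk contDiff_const
  have hd : ContDiffAt ℝ ∞ (fun s => f (s, q)) t :=
    ContDiffAt.comp t (hf.contDiffAt (hW.mem_nhds hp)) hcont.contDiffAt
  refine (hd.congr_of_eventuallyEq ?_).contDiffWithinAt
  filter_upwards [hcont.continuous.continuousAt.preimage_mem_nhds (hW.mem_nhds hp)] with s hs
  exact (hφ _ hs).symm

theorem isOpen_time (hW : IsOpen W) : IsOpen (Prod.fst '' W) := isOpenMap_fst W hW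

theorem smooth_time_mul_pow {φ : ℝ → ℝ} (hφ : ContDiffOn ℝ ∞ φ (Prod.fst '' W)) (k : ℕ) :
    ContDiffOn ℝ ∞ (fun p : Pt => φ p.1 * p.2.1 ^ k) W :=
  (hφ.comp contDiff_fst.contDiffOn fun _ hp => Set.mem_image_of_mem _ hp).mul
    ((contDiff_fst.comp contDiff_snd).pow k).contDiffOn

/-- All the explicit terms `ξ`, `χ`, `ξ_t x`, `χ_t x`, `ξ_tt x²` have this shape. At `k = 0` the
truncated exponent `k - 1` is harmless because of the factor `k`. -/
theorem dirDeriv_time_mul_pow (hW : IsOpen W) {φ : ℝ → ℝ}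
    (hφ : ContDiffOn ℝ ∞ φ (Prod.fst '' W)) {p : Pt} (hp : p ∈ W) (k : ℕ) (v : Pt) :
    dirDeriv v (fun p : Pt => φ p.1 * p.2.1 ^ k) p
      = v.1 * deriv φ p.1 * p.2.1 ^ k + φ p.1 * (k * p.2.1 ^ (k - 1) * v.2.1) := by
  have hd : HasDerivAt φ (deriv φ p.1) p.1 := ((hφ.contDiffAt ((isOpen_time hW).mem_nhds
    (Set.mem_image_of_mem _ hp))).differentiableAt (by simp)).hasDerivAt
  have h1 : HasFDerivAt (fun p : Pt => φ p.1) _ p :=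
    hd.hasFDerivAt.comp p (hasFDerivAt_fst (𝕜 := ℝ))
  have h2 : HasFDerivAt (fun p : Pt => p.2.1) _ p :=
    (hasFDerivAt_fst (𝕜 := ℝ)).comp p (hasFDerivAt_snd (𝕜 := ℝ))
  refine (congrArg (fun L => L v) (h1.mul (h2.pow k)).fderiv).trans ?_
  simp
  ring

theorem dirDeriv_sub (hW : IsOpen W) {f g : Pt → ℝ} (hf : ContDiffOn ℝ ∞ f W)
    (hg : ContDiffOn ℝ ∞ g W) {p : Pt} (hp : p ∈ W) (v : Pt) :
    dirDeriv v (fun p => f p - g p) p = dirDeriv v f p - dirDeriv v g p :=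
  congrArg (fun L => L v) ((differentiableAt_of_smooth hW hf hp).hasFDerivAt.sub
    (differentiableAt_of_smooth hW hg hp).hasFDerivAt).fderiv

theorem dirDeriv_im (hW : IsOpen W) {f : Pt → ℂ} (hf : ContDiffOn ℝ ∞ f W) {p : Pt} (hp : p ∈ W)
    (v : Pt) : dirDeriv v (fun p => (f p).im) p = (dirDeriv v f p).im :=
  congrArg (fun L => L v) (imCLM.hasFDerivAt.comp p
    (differentiableAt_of_smooth hW hf hp).hasFDerivAt).fderiv

theorem smooth_deriv_time (hW : IsOpen W) {φ : ℝ → ℝ} (hφ : ContDiffOn ℝ ∞ φ (Prod.fst '' W)) :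
    ContDiffOn ℝ ∞ (deriv φ) (Prod.fst '' W) :=
  hφ.deriv_of_isOpen (isOpen_time hW) (by simp)

end TimeFunctions

theorem exists_opD_add_opG_add_opLM {V : ℝ × ℝ → ℂ} {W : Set Pt} {Q : VField} (hW : IsOpen W)
    (hV : ∀ p ∈ W, DifferentiableAt ℝ V (p.1, p.2.1))
    (hsec : ∀ t : ℝ, IsPreconnected {q : ℝ × ℂ | (t, q) ∈ W}) (hQ : Q ∈ maxAlg V W) :
    ∃ ξ χ l : ℝ → ℝ, ContDiffOn ℝ ∞ ξ (Prod.fst '' W) ∧ ContDiffOn ℝ ∞ χ (Prod.fst '' W) ∧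
      ContDiffOn ℝ ∞ l (Prod.fst '' W) ∧ Set.EqOn Q (opD ξ + opG χ + opLM l) W := by
  have hT := smooth_xiT hQ.1
  have hX := smooth_xiX hQ.1
  have ha := smooth_dirDeriv hW (smooth_eta hQ.1) (0, 0, 1)
  obtain ⟨ξ, hξ, eT⟩ := exists_time_function hW hT hsec
    (fun p hp x z => xiT_fiberwise_const hW hV hQ hp x z)
  have hξ1 := smooth_deriv_time hW hξ
  have hξ2 := smooth_deriv_time hW hξ1
  have eTt : ∀ p ∈ W, dirDeriv (1, 0, 0) (xiT Q) p = deriv ξ p.1 := by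
    intro p hp
    rw [dirDeriv_congr hW (g := fun p => ξ p.1 * p.2.1 ^ 0) (by simpa using eT) hp,
      dirDeriv_time_mul_pow hW hξ hp]
    simp
  have hc1 : ContDiffOn ℝ ∞ (fun t => 1 / 2 * deriv ξ t) (Prod.fst '' W) :=
    contDiffOn_const.mul hξ1
  -- `χ` is the constant of integration of `ξ^x_x = ½ ξ_t` in `x`.
  obtain ⟨χ, hχ, eX⟩ := exists_time_function hW
    (f := fun p => xiX Q p - 1 / 2 * deriv ξ p.1 * p.2.1 ^ 1)
    (hX.sub (smooth_time_mul_pow hc1 1)) hsec (fun p hp x z => by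
      rw [dirDeriv_sub hW hX (smooth_time_mul_pow hc1 1) hp, dirDeriv_time_mul_pow hW hc1 hp]
      obtain ⟨h1, -, h3⟩ := determining_psiXX hW hV hQ hp
      have h2 := eTt p hp
      unfold dirDeriv at h2 ⊢
      rw [clm_split, h3]
      simp
      linear_combination x / 2 * (h2 - h1))
  have hχ1 := smooth_deriv_time hW hχ
  have eXt : ∀ p ∈ W, dirDeriv (1, 0, 0) (xiX Q) p
      = 1 / 2 * deriv (deriv ξ) p.1 * p.2.1 + deriv χ p.1 := by
    intro p hp
    have h := dirDeriv_sub hW hX (smooth_time_mul_pow hc1 1) hp (1, 0, 0)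
    rw [dirDeriv_time_mul_pow hW hc1 hp, dirDeriv_congr hW (g := fun p => χ p.1 * p.2.1 ^ 0)
      (by simpa using eX) hp, dirDeriv_time_mul_pow hW hχ hp] at h
    simp at h
    linear_combination -h
  have hc2 : ContDiffOn ℝ ∞ (fun t => 1 / 8 * deriv (deriv ξ) t) (Prod.fst '' W) :=
    contDiffOn_const.mul hξ2
  have hc3 : ContDiffOn ℝ ∞ (fun t => 1 / 2 * deriv χ t) (Prod.fst '' W) :=
    contDiffOn_const.mul hχ1
  have him : ContDiffOn ℝ ∞ (fun p => (dirDeriv (0, 0, 1) (eta Q) p).im) W :=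
    imCLM.contDiff.comp_contDiffOn ha
  -- `λ` is the constant of integration of `Im η_ψx = ½ ξ^x_t = ¼ ξ_tt x + ½ χ_t` in `x`.
  obtain ⟨l, hl, eL⟩ := exists_time_function hW
    (f := fun p => (dirDeriv (0, 0, 1) (eta Q) p).im - 1 / 8 * deriv (deriv ξ) p.1 * p.2.1 ^ 2
      - 1 / 2 * deriv χ p.1 * p.2.1 ^ 1)
    ((him.sub (smooth_time_mul_pow hc2 2)).sub (smooth_time_mul_pow hc3 1)) hsec
    (fun p hp x z => by
      rw [dirDeriv_sub hW (him.sub (smooth_time_mul_pow hc2 2)) (smooth_time_mul_pow hc3 1) hp,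
        dirDeriv_sub hW him (smooth_time_mul_pow hc2 2) hp, dirDeriv_time_mul_pow hW hc2 hp,
        dirDeriv_time_mul_pow hW hc3 hp, dirDeriv_im hW ha hp]
      have h1 := congrArg im (determining_psiX hW hV hQ hp).2.1
      have h2 : fderiv ℝ _ p (0, 0, z) = _ := (fiberAffine_eta hW hV hQ p hp z).2
      rw [eXt p hp] at h1
      have h3 : dirDeriv (0, x, z) (dirDeriv (0, 0, 1) (eta Q)) p
          = x • dirDeriv (0, 1, 0) (dirDeriv (0, 0, 1) (eta Q)) p := by
        unfold dirDeriv at h2 ⊢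
        rw [clm_split, h2]
        simp
      rw [h3]
      simp at h1 ⊢
      linear_combination x / 2 * h1)
  refine ⟨ξ, χ, l, hξ, hχ, hl, fun p hp => ?_⟩
  obtain ⟨h1, h2, -⟩ := determining_psi hW hV hQ hp
  -- The real part of `η_ψ` is not integrated: `ξ^t_t + 2 Re η_ψ = 0` fixes it as `-½ ξ_t`.
  have hre := congrArg re h1
  rw [eTt p hp] at hre
  simp at hre
  have hL := eL p hp
  have hX' := eX p hp
  simp only [pow_one] at hL hX'
  have hval : dirDeriv (0, 0, 1) (eta Q) p = (-(1 / 2 * deriv ξ p.1) : ℝ)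
      + (1 / 8 * deriv (deriv ξ) p.1 * p.2.1 ^ 2 + 1 / 2 * deriv χ p.1 * p.2.1 + l p.1 : ℝ) * I := by
    rw [← re_add_im (dirDeriv (0, 0, 1) (eta Q) p)]
    congr 2
    · norm_cast; linarith
    · congr 1; norm_cast; linarith
  refine Prod.ext ?_ (Prod.ext ?_ ?_)
  · change xiT Q p = _
    rw [eT p hp]
    simp [opD, opG, opLM, opT, opX, opM, opI]
  · change xiX Q p = _
    simp [opD, opG, opLM, opT, opX, opM, opI]
    linarith
  · change eta Q p = _
    rw [h2, hval]
    simp [opD, opG, opLM, opT, opX, opM, opI]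
    ring

end CubicSchrodinger

theorem theorem1 (Ω : Set (ℝ × ℝ)) (hΩ : IsOpen Ω)
    (V : ℝ × ℝ → ℂ) (hV : ContDiffOn ℝ ∞ V Ω)
    (W : Set CubicSchrodinger.Pt) (hW : IsOpen W)
    (hWΩ : ∀ p ∈ W, (p.1, p.2.1) ∈ Ω)
    (hsec : ∀ t : ℝ, IsPreconnected {q : ℝ × ℂ | (t, q) ∈ W})
    (Q : CubicSchrodinger.VField) (hQ : Q ∈ CubicSchrodinger.maxAlg V W) :
    (∃ R ∈ CubicSchrodinger.opSpan (Prod.fst '' W), Set.EqOn Q R W) ∧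
      ∀ p ∈ W, CubicSchrodinger.Classifying V Q p := by
  have hVd : ∀ p ∈ W, DifferentiableAt ℝ V (p.1, p.2.1) := fun p hp =>
    (hV.contDiffAt (hΩ.mem_nhds (hWΩ p hp))).differentiableAt (by simp)
  refine ⟨?_, fun p hp => CubicSchrodinger.classifying hW hVd hQ hp⟩
  obtain ⟨ξ, χ, l, hξ, hχ, hl, h⟩ :=
    CubicSchrodinger.exists_opD_add_opG_add_opLM hW hVd hsec hQ
  refine ⟨_, ?_, h⟩
  refine Submodule.add_mem _ (Submodule.add_mem _ ?_ ?_) ?_ <;> apply Submodule.subset_span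
  · exact Or.inl (Or.inl ⟨ξ, hξ, rfl⟩)
  · exact Or.inl (Or.inr ⟨χ, hχ, rfl⟩)
  · exact Or.inr ⟨l, hl, rfl⟩
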